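/- **Setting.** A hybrid mesh consists of distinct points of $\mathbb{R}^3$ (the vertices), finitely many tetrahedra, each given by 4 distinct vertices, and finitely many hexahedra, each given by 8 distinct vertices placed at the corners of a combinatorial cube (which defines the edges, faces and face diagonals of the hexahedron), such that: * two distinct tetrahedra share at most 3 vertices; * two distinct hexahedra share 0, 1, 2 or 4 vertices; if they share 2 vertices these form a common edge, if they share 4 vertices these form a common face; * a hexahedron and a tetrahedron share at most 3 vertices; if a hexahedron $Q$ and a tetrahedron $T$ share 3 vertices, there is another tetrahedron $T'$ which shares 3 vertices with $Q$ and 2 or 3 vertices with $T$, and the vertices that $T$ and $T'$ share with $Q$ together are the vertices of one face of $Q$. Let $\hat Q=[0,1]^3$, and let $\hat T$ be the tetrahedron with vertices $\hat s_1=0$, $\hat s_2=e_1$, $\hat s_3=e_2$, $\hat s_4=e_3$. Let $\mathbb{Q}_1$ be the space of real polynomials in three variables of degree at most 1 in each variable, and $\mathbb{P}_2$ the space of those of total degree at most 2. Each cell $c$ has a mapping $F_c$: for a hexahedron, $F_c\in(\mathbb{Q}_1)^3$ maps the corners of $\hat Q$ to the corresponding vertices; for a tetrahedron with vertices $a_1,\dots,a_4$,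 $F_c\in(\mathbb{P}_2)^3$ is determined by $F_c(\hat s_j)=a_j$ and, for $j<k$, $F_c(\tfrac{\hat s_j+\hat s_k}{2})=\tfrac14(a_j+a_k+a_l+a_f)$ if $\{a_j,a_k\}$ is a diagonal of a face, with vertices $a_j,a_l,a_k,a_f$, of some hexahedron of the mesh, and $F_c(\tfrac{\hat s_j+\hat s_k}{2})=\tfrac12(a_j+a_k)$ otherwise. All cells are assumed to be non-degenerate: $F_c$ is one-to-one on the closed reference element ($\hat Q$ or $\hat T$) and $\det DF_c\neq 0$ at each of its points. Let $K_c$ be the image of the reference element under $F_c$, let $\Omega_h=\bigcup_c K_c$, and let $H^1(\Omega_h)$ be the Sobolev space of the interior $U$ of $\Omega_h$, with inner product $\int_{U} uv+\int_{U}\nabla u\cdot\nabla v$. Let $\mathcal{H}yb_{12}$ be the space of continuous functions $v:\Omega_h\to\mathbb{R}$ such that on every cell $v|_{K_c}=\hat v_c\circ F_c^{-1}$ with $\hat v_c\in\mathbb{P}_2$ if $c$ is a tetrahedron and $\hat v_c\in\mathbb{Q}_1$ if $c$ is a hexahedron. Let $\mathcal{H}yb_1$ be the space of all $v\in\mathcal{H}yb_{12}$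 such that, for any two distinct tetrahedra $T_1,T_2$ sharing exactly 3 vertices and any edge between two of these common vertices that is not a diagonal of a face of a hexahedron of the mesh, the values of $\hat v_{T_1}$ and $\hat v_{T_2}$ at the midpoints of the corresponding reference edges agree and are the averages of the values of $\hat v_{T_1}$, respectively $\hat v_{T_2}$, at the two endpoints of that reference edge. Let $\mathcal{H}yb_1'$ be the space of all $v\in\mathcal{H}yb_{12}$ for which this average condition holds on every edge of every tetrahedron that is not a diagonal of a face of a hexahedron of the mesh. **Proposition.** $\mathcal{H}yb_{12}$ and $\mathcal{H}yb_1$ are subspaces of $H^1(\Omega_h)$: the restriction to $U$ of each $v\in\mathcal{H}yb_{12}$ belongs to $H^1(U)$, and the resulting linear map $\mathcal{H}yb_{12}\to H^1(U)$ is injective. The images of $\mathcal{H}yb_{12}$ and of $\mathcal{H}yb_1$ under this map are complete for the $H^1$ norm, so $\mathcal{H}yb_{12}$ and $\mathcal{H}yb_1$ are Hilbert spaces with the $H^1$ inner product. The same holds for $\mathcal{H}yb_1'$. -/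

import Mathlib

open MeasureTheory Set
open scoped ContDiff

noncomputable section

/-- Three-dimensional Euclidean space. -/
abbrev E3 : Type := EuclideanSpace ℝ (Fin 3)

/-! ### The Sobolev space `H¹(U)` -/

/-- `g` is the weak gradient of `u` on the open set `U`:
`∫_U u ∂ᵢφ = - ∫_U gᵢ φ` for every test function `φ ∈ C_c^∞(U)` and every `i`. -/
def IsWeakGradient (U : Set E3) (u : E3 → ℝ) (g : E3 → E3) : Prop :=
  ∀ φ : E3 → ℝ, ContDiff ℝ ∞ φ → HasCompactSupport φ → tsupport φ ⊆ U → ∀ i : Fin 3,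
    ∫ x in U, u x * fderiv ℝ φ x (EuclideanSpace.single i 1) = - ∫ x in U, g x i * φ x

/-- The Hilbert space `L²(U) × L²(U; ℝ³)`, with
`⟪(u, g), (v, h)⟫ = ∫_U u v + ∫_U g · h`. -/
abbrev L2Pair (U : Set E3) : Type :=
  WithLp 2 (Lp ℝ 2 (volume.restrict U) × Lp E3 2 (volume.restrict U))

lemma integrable_mul_fderiv_test {U : Set E3} (u : Lp ℝ 2 (volume.restrict U))
    {φ : E3 → ℝ} (hφ : ContDiff ℝ ∞ φ) (hc : HasCompactSupport φ) (e : E3) :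
    Integrable (fun x => u x * fderiv ℝ φ x e) (volume.restrict U) := by
  have h1 : Continuous (fun x => fderiv ℝ φ x e) :=
    (hφ.continuous_fderiv (by simp)).clm_apply continuous_const
  have h2 : HasCompactSupport (fun x => fderiv ℝ φ x e) := hc.fderiv_apply ℝ e
  exact (Lp.memLp u).integrable_mul (q := 2) (h1.memLp_of_hasCompactSupport h2)

lemma integrable_coord_mul_test {U : Set E3} (g : Lp E3 2 (volume.restrict U))
    {φ : E3 → ℝ} (hφ : ContDiff ℝ ∞ φ) (hc : HasCompactSupport φ) (i : Fin 3) :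
    Integrable (fun x => g x i * φ x) (volume.restrict U) := by
  have h1 : MemLp (fun x => g x i) 2 (volume.restrict U) :=
    (EuclideanSpace.proj (𝕜 := ℝ) i).comp_memLp' (Lp.memLp g)
  exact h1.integrable_mul (q := 2) (hφ.continuous.memLp_of_hasCompactSupport hc)

/-- The Sobolev space `H¹(U)`, realised as the space of pairs `(u, ∇u)` with `u ∈ L²(U)` having
a weak gradient `∇u ∈ L²(U; ℝ³)`. The inherited inner product is the usual one,
`∫_U u v + ∫_U ∇u · ∇v`; since the weak gradient is unique, the pair is determined by `u`. -/
def H1 (U : Set E3) : Submodule ℝ (L2Pair U) where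
  carrier := {w | IsWeakGradient U w.fst w.snd}
  zero_mem' := by
    intro φ hφ hc hs i
    have h1 : ∀ᵐ x ∂(volume.restrict U), ((0 : Lp ℝ 2 (volume.restrict U)) : E3 → ℝ) x = 0 :=
      Lp.coeFn_zero _ _ _
    have h2 : ∀ᵐ x ∂(volume.restrict U), ((0 : Lp E3 2 (volume.restrict U)) : E3 → E3) x = 0 :=
      Lp.coeFn_zero _ _ _
    have e1 := integral_eq_zero_of_ae (μ := volume.restrict U)
      (f := fun x => ((0 : Lp ℝ 2 (volume.restrict U)) : E3 → ℝ) x *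
        fderiv ℝ φ x (EuclideanSpace.single i 1))
      (by filter_upwards [h1] with x hx; rw [hx, zero_mul, Pi.zero_apply])
    have e2 := integral_eq_zero_of_ae (μ := volume.restrict U)
      (f := fun x => ((0 : Lp E3 2 (volume.restrict U)) : E3 → E3) x i * φ x)
      (by filter_upwards [h2] with x hx; rw [hx, PiLp.zero_apply, zero_mul, Pi.zero_apply])
    change ∫ x in U, ((0 : Lp ℝ 2 (volume.restrict U)) : E3 → ℝ) x * _
      = - ∫ x in U, ((0 : Lp E3 2 (volume.restrict U)) : E3 → E3) x i * φ x
    rw [e1, e2, neg_zero]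
  add_mem' := by
    intro a b ha hb φ hφ hc hs i
    have ea := ha φ hφ hc hs i
    have eb := hb φ hφ hc hs i
    have e1 : ∫ x in U, (a + b).fst x * fderiv ℝ φ x (EuclideanSpace.single i 1)
        = ∫ x in U, (a.fst x * fderiv ℝ φ x (EuclideanSpace.single i 1)
          + b.fst x * fderiv ℝ φ x (EuclideanSpace.single i 1)) := by
      refine integral_congr_ae ?_
      filter_upwards [Lp.coeFn_add a.fst b.fst] with x hx
      rw [WithLp.add_fst, hx, Pi.add_apply, add_mul]
    have e2 : ∫ x in U, (a + b).snd x i * φ x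
        = ∫ x in U, (a.snd x i * φ x + b.snd x i * φ x) := by
      refine integral_congr_ae ?_
      filter_upwards [Lp.coeFn_add a.snd b.snd] with x hx
      rw [WithLp.add_snd, hx, Pi.add_apply, PiLp.add_apply, add_mul]
    rw [e1, e2, integral_add (integrable_mul_fderiv_test _ hφ hc _)
      (integrable_mul_fderiv_test _ hφ hc _), integral_add (integrable_coord_mul_test _ hφ hc _)
      (integrable_coord_mul_test _ hφ hc _), ea, eb]
    ring
  smul_mem' := by
    intro r a ha φ hφ hc hs i
    have ea := ha φ hφ hc hs i
    have e1 : ∫ x in U, (r • a).fst x * fderiv ℝ φ x (EuclideanSpace.single i 1)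
        = ∫ x in U, r * (a.fst x * fderiv ℝ φ x (EuclideanSpace.single i 1)) := by
      refine integral_congr_ae ?_
      filter_upwards [Lp.coeFn_smul r a.fst] with x hx
      rw [WithLp.smul_fst, hx, Pi.smul_apply, smul_eq_mul, mul_assoc]
    have e2 : ∫ x in U, (r • a).snd x i * φ x = ∫ x in U, r * (a.snd x i * φ x) := by
      refine integral_congr_ae ?_
      filter_upwards [Lp.coeFn_smul r a.snd] with x hx
      rw [WithLp.smul_snd, hx, Pi.smul_apply, PiLp.smul_apply, smul_eq_mul, mul_assoc]
    rw [e1, e2, integral_const_mul, integral_const_mul, ea]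
    ring

/-! ### Reference elements and Lagrange bases -/

/-- Barycentric coordinates of the reference tetrahedron. -/
def bary (i : Fin 4) (x : E3) : ℝ :=
  ![1 - x 0 - x 1 - x 2, x 0, x 1, x 2] i

/-- The reference tetrahedron `T̂`, with vertices `0, e₁, e₂, e₃`. -/
def refTet : Set E3 := {x | ∀ i, 0 ≤ bary i x}

/-- The vertices of the reference tetrahedron. -/
def tetNode (i : Fin 4) : E3 :=
  ![0, EuclideanSpace.single 0 1, EuclideanSpace.single 1 1, EuclideanSpace.single 2 1] i

lemma bary_tetNode (i j : Fin 4) : bary i (tetNode j) = if i = j then 1 else 0 := by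
  fin_cases i <;> fin_cases j <;> simp [bary, tetNode]

lemma tetNode_mem (i : Fin 4) : tetNode i ∈ refTet := by
  intro k
  rw [bary_tetNode]
  split_ifs <;> norm_num

lemma bary_midpoint (i : Fin 4) (x y : E3) :
    bary i (midpoint ℝ x y) = (bary i x + bary i y) / 2 := by
  fin_cases i <;> simp [bary, midpoint_eq_smul_add] <;> ring

lemma tetMid_mem (i j : Fin 4) : midpoint ℝ (tetNode i) (tetNode j) ∈ refTet := by
  intro k
  rw [bary_midpoint]
  have h1 := tetNode_mem i k
  have h2 := tetNode_mem j k
  linarith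

/-- The vertices of the unit cube, labelled by their coordinates. -/
abbrev Corner : Type := Fin 3 → Fin 2

/-- The reference hexahedron `Q̂ = [0,1]³`. -/
def refHex : Set E3 := {x | ∀ i, x i ∈ Icc (0 : ℝ) 1}

/-- The tri-affine Lagrange basis of `ℚ₁` attached to the vertices of the cube. -/
def triAffine (c : Corner) (x : E3) : ℝ :=
  ∏ i, if c i = 0 then 1 - x i else x i

/-! ### Hybrid hexahedral-tetrahedral meshes -/

/-- The vertex labels of a face of the cube (the one where coordinate `d` equals `s`). -/
def cubeFace (d : Fin 3) (s : Fin 2) : Set Corner := {c | c d = s}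

/-- The vertex labels of an edge of the cube (the one through `c₀` in direction `d`). -/
def cubeEdge (d : Fin 3) (c₀ : Corner) : Set Corner := {c | ∀ k, k ≠ d → c k = c₀ k}

/-- Combinatorial hybrid mesh: distinct points of space (vertices, labelled by `V`), tetrahedra
(labelled by `T`) given by 4 vertices, and hexahedra (labelled by `H`) given by 8 vertices, placed
at the corners of a combinatorial cube (so that their edges and faces are those of the cube),
with the allowed adjacencies. -/
structure HybridMesh (V T H : Type*) where
  /-- coordinates of the vertices -/
  pos : V ↪ E3
  /-- the 4 vertices of a tetrahedron -/
  tet : T → Fin 4 ↪ V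
  /-- the 8 vertices of a hexahedron -/
  hex : H → Corner ↪ V
  /-- two tetrahedra share 0, 1, 2 or 3 vertices -/
  tet_tet : ∀ t t', t ≠ t' → (range (tet t) ∩ range (tet t')).ncard ≤ 3
  /-- two hexahedra share 0, 1, 2 or 4 vertices -/
  hex_hex : ∀ q q', q ≠ q' →
    (range (hex q) ∩ range (hex q')).ncard ∈ ({0, 1, 2, 4} : Set ℕ)
  /-- when two hexahedra share 2 vertices, these form a common edge -/
  hex_hex_two : ∀ q q', q ≠ q' → (range (hex q) ∩ range (hex q')).ncard = 2 →
    ∃ d c d' c', range (hex q) ∩ range (hex q') = hex q '' cubeEdge d c ∧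
      range (hex q) ∩ range (hex q') = hex q' '' cubeEdge d' c'
  /-- when two hexahedra share 4 vertices, these form a common face -/
  hex_hex_four : ∀ q q', q ≠ q' → (range (hex q) ∩ range (hex q')).ncard = 4 →
    ∃ d s d' s', range (hex q) ∩ range (hex q') = hex q '' cubeFace d s ∧
      range (hex q) ∩ range (hex q') = hex q' '' cubeFace d' s'
  /-- a hexahedron and a tetrahedron share 0, 1, 2 or 3 vertices -/
  hex_tet : ∀ q t, (range (hex q) ∩ range (tet t)).ncard ≤ 3
  /-- when a hexahedron and a tetrahedron share 3 vertices, another tetrahedron shares 3 vertices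
  with the hexahedron and 2 or 3 vertices with the tetrahedron, and the two tetrahedra are
  connected to one and the same face of the hexahedron -/
  hex_tet_three : ∀ q t, (range (hex q) ∩ range (tet t)).ncard = 3 →
    ∃ t', t' ≠ t ∧ (range (hex q) ∩ range (tet t')).ncard = 3 ∧
      (range (tet t) ∩ range (tet t')).ncard ∈ ({2, 3} : Set ℕ) ∧
      ∃ d s, (range (hex q) ∩ range (tet t)) ∪ (range (hex q) ∩ range (tet t'))
        = hex q '' cubeFace d s

namespace HybridMesh

/-- `{a, b}` is a diagonal of the face `(d, s)` of the hexahedron `q`. -/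
def IsDiagonal {V T H : Type*} (M : HybridMesh V T H) (q : H) (d : Fin 3) (s : Fin 2)
    (a b : V) : Prop :=
  ∃ c ∈ cubeFace d s, ∃ c' ∈ cubeFace d s, (∀ k, k ≠ d → c k ≠ c' k) ∧
    M.hex q c = a ∧ M.hex q c' = b

/-- `{a, b}` is a diagonal of some face of some hexahedron of the mesh. -/
def IsFaceDiagonal {V T H : Type*} (M : HybridMesh V T H) (a b : V) : Prop :=
  ∃ f : H × Fin 3 × Fin 2, M.IsDiagonal f.1 f.2.1 f.2.2 a b

/-- The mean of the four vertices of a face of a hexahedron. -/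
def faceCenter {V T H : Type*} (M : HybridMesh V T H) (f : H × Fin 3 × Fin 2) : E3 :=
  (1 / 4 : ℝ) • ∑ c : Corner with c f.2.1 = f.2.2, M.pos (M.hex f.1 c)

open Classical in
/-- The node attached to the edge `{a, b}` of a tetrahedron: the centre of the hexahedron face of
which `{a, b}` is a diagonal if there is one (it does not depend on the choice of that face, see
`midNode_eq_faceCenter`), and the midpoint of the edge otherwise. -/
def midNode {V T H : Type*} (M : HybridMesh V T H) (a b : V) : E3 :=
  if h : M.IsFaceDiagonal a b then M.faceCenter h.choose
  else midpoint ℝ (M.pos a) (M.pos b)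

/-- The tri-affine mapping `F = ∑ aᵢ ψ̂ᵢ` of a hexahedron. -/
def hexMap {V T H : Type*} (M : HybridMesh V T H) (q : H) (x : E3) : E3 :=
  ∑ c : Corner, triAffine c x • M.pos (M.hex q c)

/-- The quadratic mapping `F = ∑ aᵢ φ̂ᵢ + ∑_{i<j} aᵢⱼ φ̂ᵢⱼ` of a tetrahedron, where
`φ̂ᵢ = λᵢ (2 λᵢ - 1)` and `φ̂ᵢⱼ = 4 λᵢ λⱼ`. -/
def tetMap {V T H : Type*} (M : HybridMesh V T H) (t : T) (x : E3) : E3 :=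
  ∑ i : Fin 4, (bary i x * (2 * bary i x - 1)) • M.pos (M.tet t i)
    + ∑ i : Fin 4, ∑ j ∈ Finset.Ioi i,
        (4 * bary i x * bary j x) • M.midNode (M.tet t i) (M.tet t j)

/-- All cells are non-degenerate: each element mapping is one-to-one on the (closed) reference
element and its Jacobian determinant does not vanish there. -/
def IsNondegenerate {V T H : Type*} (M : HybridMesh V T H) : Prop :=
  (∀ t, InjOn (M.tetMap t) refTet ∧ ∀ x ∈ refTet, (fderiv ℝ (M.tetMap t) x).det ≠ 0) ∧
  (∀ q, InjOn (M.hexMap q) refHex ∧ ∀ x ∈ refHex, (fderiv ℝ (M.hexMap q) x).det ≠ 0)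

/-- The meshed region `Ω_h`, the union of the closed cells. -/
def region {V T H : Type*} (M : HybridMesh V T H) : Set E3 :=
  (⋃ t, M.tetMap t '' refTet) ∪ (⋃ q, M.hexMap q '' refHex)

lemma tetMap_mem {V T H : Type*} (M : HybridMesh V T H) (t : T) {x : E3} (hx : x ∈ refTet) :
    M.tetMap t x ∈ M.region :=
  Or.inl (mem_iUnion.2 ⟨t, mem_image_of_mem _ hx⟩)

lemma hexMap_mem {V T H : Type*} (M : HybridMesh V T H) (q : H) {x : E3} (hx : x ∈ refHex) :
    M.hexMap q x ∈ M.region :=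
  Or.inr (mem_iUnion.2 ⟨q, mem_image_of_mem _ hx⟩)

/-- The pull-back `v̂ = v ∘ F` of `v` to the reference tetrahedron. -/
def tetPull {V T H : Type*} (M : HybridMesh V T H) (v : C(M.region, ℝ)) (t : T) (x : refTet) : ℝ :=
  v ⟨M.tetMap t x, M.tetMap_mem t x.2⟩

/-- The pull-back `v̂ = v ∘ F` of `v` to the reference hexahedron. -/
def hexPull {V T H : Type*} (M : HybridMesh V T H) (v : C(M.region, ℝ)) (q : H) (x : refHex) : ℝ :=
  v ⟨M.hexMap q x, M.hexMap_mem q x.2⟩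

/-- `ℋyb₁₂`: the continuous functions on `Ω_h` whose restriction to each cell `K` is `v̂ ∘ F_K⁻¹`
with `v̂ ∈ ℙ₂` (total degree at most 2) on tetrahedra and `v̂ ∈ ℚ₁` (degree at most 1 in each
variable) on hexahedra. -/
def hyb12 {V T H : Type*} (M : HybridMesh V T H) : Submodule ℝ C(M.region, ℝ) where
  carrier := {v |
    (∀ t, ∃ p ∈ MvPolynomial.restrictTotalDegree (Fin 3) ℝ 2,
      ∀ x : refTet, M.tetPull v t x = MvPolynomial.eval (fun i => x.1 i) p) ∧
    (∀ q, ∃ p ∈ MvPolynomial.restrictDegree (Fin 3) ℝ 1,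
      ∀ x : refHex, M.hexPull v q x = MvPolynomial.eval (fun i => x.1 i) p)}
  zero_mem' := ⟨fun _ => ⟨0, Submodule.zero_mem _, fun _ => by simp [tetPull]⟩,
    fun _ => ⟨0, Submodule.zero_mem _, fun _ => by simp [hexPull]⟩⟩
  add_mem' := by
    rintro a b ⟨ha, ha'⟩ ⟨hb, hb'⟩
    refine ⟨fun t => ?_, fun q => ?_⟩
    · obtain ⟨p, hp, hpe⟩ := ha t
      obtain ⟨r, hr, hre⟩ := hb t
      exact ⟨p + r, Submodule.add_mem _ hp hr, fun x => by
        rw [map_add, ← hpe x, ← hre x]; rfl⟩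
    · obtain ⟨p, hp, hpe⟩ := ha' q
      obtain ⟨r, hr, hre⟩ := hb' q
      exact ⟨p + r, Submodule.add_mem _ hp hr, fun x => by
        rw [map_add, ← hpe x, ← hre x]; rfl⟩
  smul_mem' := by
    rintro k a ⟨ha, ha'⟩
    refine ⟨fun t => ?_, fun q => ?_⟩
    · obtain ⟨p, hp, hpe⟩ := ha t
      exact ⟨k • p, Submodule.smul_mem _ k hp, fun x => by
        rw [MvPolynomial.smul_eval, ← hpe x]; rfl⟩
    · obtain ⟨p, hp, hpe⟩ := ha' q
      exact ⟨k • p, Submodule.smul_mem _ k hp, fun x => by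
        rw [MvPolynomial.smul_eval, ← hpe x]; rfl⟩

/-- The value of `v̂` at the vertex `i` of the tetrahedron `t`. -/
def nodeVal {V T H : Type*} (M : HybridMesh V T H) (v : C(M.region, ℝ)) (t : T) (i : Fin 4) : ℝ :=
  M.tetPull v t ⟨tetNode i, tetNode_mem i⟩

/-- The value of `v̂` at the midpoint of the reference edge `i - j` of the tetrahedron `t`. -/
def midVal {V T H : Type*} (M : HybridMesh V T H) (v : C(M.region, ℝ)) (t : T) (i j : Fin 4) : ℝ :=
  M.tetPull v t ⟨midpoint ℝ (tetNode i) (tetNode j), tetMid_mem i j⟩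

/-- `ℋyb₁`: the functions of `ℋyb₁₂` such that, for any two tetrahedra with a common face and any
common edge of theirs in that face which is not a diagonal of a hexahedron face, the values of the
two pull-backs at the edge midpoint agree, and are the average of the values at the two ends. -/
def hyb1 {V T H : Type*} (M : HybridMesh V T H) : Submodule ℝ C(M.region, ℝ) where
  carrier := {v | v ∈ M.hyb12 ∧
    ∀ t t', t ≠ t' → (range (M.tet t) ∩ range (M.tet t')).ncard = 3 →
    ∀ i j i' j', i ≠ j → M.tet t i = M.tet t' i' → M.tet t j = M.tet t' j' →
      ¬ M.IsFaceDiagonal (M.tet t i) (M.tet t j) →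
      M.midVal v t i j = M.midVal v t' i' j' ∧
      M.midVal v t i j = (M.nodeVal v t i + M.nodeVal v t j) / 2 ∧
      M.midVal v t' i' j' = (M.nodeVal v t' i' + M.nodeVal v t' j') / 2}
  zero_mem' := ⟨Submodule.zero_mem _, by
    intros; simp [midVal, nodeVal, tetPull]⟩
  add_mem' := by
    rintro a b ⟨ha, ha'⟩ ⟨hb, hb'⟩
    refine ⟨Submodule.add_mem _ ha hb, ?_⟩
    intro t t' h1 h2 i j i' j' h3 h4 h5 h6
    obtain ⟨p1, p2, p3⟩ := ha' t t' h1 h2 i j i' j' h3 h4 h5 h6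
    obtain ⟨r1, r2, r3⟩ := hb' t t' h1 h2 i j i' j' h3 h4 h5 h6
    simp only [midVal, nodeVal, tetPull, ContinuousMap.add_apply] at *
    refine ⟨?_, ?_, ?_⟩ <;> linarith
  smul_mem' := by
    rintro k a ⟨ha, ha'⟩
    refine ⟨Submodule.smul_mem _ k ha, ?_⟩
    intro t t' h1 h2 i j i' j' h3 h4 h5 h6
    obtain ⟨p1, p2, p3⟩ := ha' t t' h1 h2 i j i' j' h3 h4 h5 h6
    simp only [midVal, nodeVal, tetPull, ContinuousMap.smul_apply, smul_eq_mul] at *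
    rw [p1, p3]
    rw [p1, p3] at p2
    refine ⟨rfl, ?_, ?_⟩
    · rw [p2]; ring
    · ring

/-- The variant of `ℋyb₁` in which the midpoint value is the average of the values at the two ends
on every edge of every tetrahedron (interior to the mesh or not) that is not a diagonal of a
hexahedron face. -/
def hyb1Full {V T H : Type*} (M : HybridMesh V T H) : Submodule ℝ C(M.region, ℝ) where
  carrier := {v | v ∈ M.hyb12 ∧
    ∀ t i j, i ≠ j → ¬ M.IsFaceDiagonal (M.tet t i) (M.tet t j) →
      M.midVal v t i j = (M.nodeVal v t i + M.nodeVal v t j) / 2}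
  zero_mem' := ⟨Submodule.zero_mem _, by
    intros; simp [midVal, nodeVal, tetPull]⟩
  add_mem' := by
    rintro a b ⟨ha, ha'⟩ ⟨hb, hb'⟩
    refine ⟨Submodule.add_mem _ ha hb, ?_⟩
    intro t i j h1 h2
    have p := ha' t i j h1 h2
    have r := hb' t i j h1 h2
    simp only [midVal, nodeVal, tetPull, ContinuousMap.add_apply] at *
    linarith
  smul_mem' := by
    rintro k a ⟨ha, ha'⟩
    refine ⟨Submodule.smul_mem _ k ha, ?_⟩
    intro t i j h1 h2
    have p := ha' t i j h1 h2
    simp only [midVal, nodeVal, tetPull, ContinuousMap.smul_apply, smul_eq_mul] at *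
    rw [p]; ring

lemma isDiagonal_mem_range {V T H : Type*} (M : HybridMesh V T H) {q : H} {d : Fin 3} {s : Fin 2}
    {a b : V} (h : M.IsDiagonal q d s a b) : a ∈ range (M.hex q) ∧ b ∈ range (M.hex q) := by
  obtain ⟨c, -, c', -, -, rfl, rfl⟩ := h
  exact ⟨mem_range_self _, mem_range_self _⟩

lemma isDiagonal_ne {V T H : Type*} (M : HybridMesh V T H) {q : H} {d : Fin 3} {s : Fin 2}
    {a b : V} (h : M.IsDiagonal q d s a b) : a ≠ b := by
  obtain ⟨c, -, c', -, hn, rfl, rfl⟩ := h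
  intro e
  have := (M.hex q).injective e
  subst this
  obtain ⟨k, hk⟩ := exists_ne d
  exact hn k hk rfl

/-- A face diagonal is contained in only one face of its hexahedron. -/
lemma isDiagonal_face_unique {V T H : Type*} (M : HybridMesh V T H) {q : H} {d d' : Fin 3}
    {s s' : Fin 2} {a b : V} (h : M.IsDiagonal q d s a b)
    (ha : a ∈ M.hex q '' cubeFace d' s') (hb : b ∈ M.hex q '' cubeFace d' s') :
    d = d' ∧ s = s' := by
  obtain ⟨c, hc, c', hc', hn, rfl, rfl⟩ := h
  rw [(M.hex q).injective.mem_set_image] at ha hb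
  have hd : d = d' := by
    by_contra hne
    exact hn d' (Ne.symm hne) (Eq.trans ha (Eq.symm hb))
  subst hd
  exact ⟨rfl, Eq.trans (Eq.symm hc) ha⟩

lemma isDiagonal_not_edge {V T H : Type*} (M : HybridMesh V T H) {q : H} {d d' : Fin 3}
    {s : Fin 2} {c₀ : Corner} {a b : V} (h : M.IsDiagonal q d s a b)
    (ha : a ∈ M.hex q '' cubeEdge d' c₀) (hb : b ∈ M.hex q '' cubeEdge d' c₀) : False := by
  obtain ⟨c, hc, c', hc', hn, rfl, rfl⟩ := h
  rw [(M.hex q).injective.mem_set_image] at ha hb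
  have hk : ∃ k : Fin 3, k ≠ d ∧ k ≠ d' := by
    clear * -
    revert d d'; decide
  obtain ⟨k, h1, h2⟩ := hk
  exact hn k h1 (Eq.trans (ha k h2) (Eq.symm (hb k h2)))

lemma faceCenter_congr {V T H : Type*} (M : HybridMesh V T H) {q q' : H} {d d' : Fin 3}
    {s s' : Fin 2} (h : M.hex q '' cubeFace d s = M.hex q' '' cubeFace d' s') :
    M.faceCenter (q, d, s) = M.faceCenter (q', d', s') := by
  classical
  have key : ∀ (q : H) (d : Fin 3) (s : Fin 2),
      ∑ c : Corner with c d = s, M.pos (M.hex q c)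
        = ∑ᶠ a ∈ M.hex q '' cubeFace d s, M.pos a := by
    intro q d s
    rw [finsum_mem_image ((M.hex q).injective.injOn)]
    rw [← finsum_mem_coe_finset]
    simp [cubeFace]
  simp only [faceCenter]
  rw [key, key, h]

/-- The node attached to a face diagonal does not depend on the face chosen to define it. -/
theorem midNode_eq_faceCenter {V T H : Type*} (M : HybridMesh V T H) {q : H} {d : Fin 3}
    {s : Fin 2} {a b : V} (h : M.IsDiagonal q d s a b) :
    M.midNode a b = M.faceCenter (q, d, s) := by
  classical
  have hex : M.IsFaceDiagonal a b := ⟨(q, d, s), h⟩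
  rw [midNode, dif_pos hex]
  have h' := hex.choose_spec
  generalize hex.choose = f at h'
  obtain ⟨q', d', s'⟩ := f
  change M.IsDiagonal q' d' s' a b at h'
  by_cases hq : q = q'
  · subst hq
    have : d = d' ∧ s = s' := by
      refine M.isDiagonal_face_unique h ?_ ?_ <;>
      obtain ⟨c, hc, c', hc', -, rfl, rfl⟩ := h'
      · exact mem_image_of_mem _ hc
      · exact mem_image_of_mem _ hc'
    rw [this.1, this.2]
  · have ra := M.isDiagonal_mem_range h
    have ra' := M.isDiagonal_mem_range h'
    have hab := M.isDiagonal_ne h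
    have ia : a ∈ range (M.hex q) ∩ range (M.hex q') := ⟨ra.1, ra'.1⟩
    have ib : b ∈ range (M.hex q) ∩ range (M.hex q') := ⟨ra.2, ra'.2⟩
    have fin : (range (M.hex q) ∩ range (M.hex q')).Finite :=
      (finite_range _).subset inter_subset_left
    have two : 2 ≤ (range (M.hex q) ∩ range (M.hex q')).ncard := by
      rw [← ncard_pair hab]
      exact ncard_le_ncard (by rintro x (rfl | rfl) <;> assumption) fin
    rcases M.hex_hex q q' hq with h0 | h0 | h0 | h0
    · omega
    · omega
    · obtain ⟨d₁, c₁, d₂, c₂, e1, -⟩ := M.hex_hex_two q q' hq h0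
      exact (M.isDiagonal_not_edge h (e1 ▸ ia) (e1 ▸ ib)).elim
    · obtain ⟨d₁, s₁, d₂, s₂, e1, e2⟩ := M.hex_hex_four q q' hq h0
      obtain ⟨rfl, rfl⟩ := M.isDiagonal_face_unique h (e1 ▸ ia) (e1 ▸ ib)
      obtain ⟨rfl, rfl⟩ := M.isDiagonal_face_unique h' (e2 ▸ ia) (e2 ▸ ib)
      exact M.faceCenter_congr (e2.symm.trans e1)

end HybridMesh

end

noncomputable section

open Filter Topology
open scoped NNReal

/-! The functions in question are Lipschitz on each cell. Non-degeneracy makes the element mapping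
an injective `C¹` map with invertible derivatives on a compact reference element, so increments of a
polynomial there are controlled by increments of the mapping (`exists_abs_sub_le_mul_norm_sub`).
Continuity across the finitely many closed cells then glues the cellwise bounds along every segment
contained in the region (`abs_sub_le_of_finite_closed_cover`). This crossing argument replaces any
matching of traces on common faces and needs no information on how the cells meet.

On the interior `U`, which has finite volume, a bounded function with such a bound is differentiable
almost everywhere by Rademacher's theorem, its gradient is bounded, and integration by parts shows
that this pointwise gradient is the weak one (`LipschitzOnSegments.isWeakGradient`). Hence `f ↦ (f,
∇f)` maps into `H¹(U)`.

For injectivity, a function vanishing almost everywhere on `U` vanishes on `U` by continuity, then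
on the whole region because `U` is dense in it (`region_subset_closure_interior`).

Completeness is a matter of dimension: a function is determined by its pull-backs, which lie in
finitely many polynomial spaces of bounded degree. So `hyb12` is finite-dimensional, and images of
its subspaces are complete in any norm. -/

/-! ### Piecewise Lipschitz functions -/

/-- A continuous function on an interval covered by finitely many closed sets, on each of which it
is Lipschitz, is Lipschitz on the whole interval. -/
lemma abs_sub_le_of_finite_closed_cover {ι : Type*} {A : ι → Set ℝ} (hA : ∀ i, IsClosed (A i))
    {f : ℝ → ℝ} {b L : ℝ} (s : Finset ι) {a : ℝ} (hab : a ≤ b) (hf : ContinuousOn f (Icc a b))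
    (hcov : Icc a b ⊆ ⋃ i ∈ s, A i)
    (hL : ∀ i ∈ s, ∀ x ∈ A i ∩ Icc a b, ∀ y ∈ A i ∩ Icc a b, |f x - f y| ≤ L * |x - y|) :
    |f b - f a| ≤ L * (b - a) := by
  classical
  -- Induction on the number of sets, the left endpoint being free. If `A i` contains `a`, its last
  -- point `σ` is reached at cost `L * (σ - a)`, and `A i` is no longer needed beyond `σ`.
  induction h : s.card generalizing s a with
  | zero =>
    have := hcov (left_mem_Icc.2 hab)
    simp [Finset.card_eq_zero.1 h] at this
  | succ n ih =>
    obtain ⟨i, hi, hai⟩ : ∃ i ∈ s, a ∈ A i := by simpa using hcov (left_mem_Icc.2 hab)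
    have hcomp : IsCompact (A i ∩ Icc a b) := isCompact_Icc.inter_left (hA i)
    have hne : (A i ∩ Icc a b).Nonempty := ⟨a, hai, left_mem_Icc.2 hab⟩
    have hσ := hcomp.sSup_mem hne
    set σ := sSup (A i ∩ Icc a b)
    have h1 : |f σ - f a| ≤ L * (σ - a) := by
      have := hL i hi σ hσ a ⟨hai, left_mem_Icc.2 hab⟩
      rwa [abs_of_nonneg (sub_nonneg.2 hσ.2.1)] at this
    have h2 : |f b - f σ| ≤ L * (b - σ) := by
      rcases hσ.2.2.eq_or_lt with e | hlt
      · simp [e]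
      -- The remaining sets are only known to cover `Icc t b` for `t` strictly beyond `σ`; the bound
      -- at `σ` itself follows by continuity as `t → σ`.
      have key : ∀ t ∈ Ioo σ b, |f b - f t| ≤ L * (b - t) := by
        intro t ht
        have hsub : Icc t b ⊆ Icc a b := Icc_subset_Icc_left (hσ.2.1.trans ht.1.le)
        refine ih (s.erase i) ht.2.le (hf.mono hsub) ?_ ?_ ?_
        · intro x hx
          obtain ⟨j, hj, hxj⟩ : ∃ j ∈ s, x ∈ A j := by simpa using hcov (hsub hx)
          have hji : j ≠ i := by
            rintro rfl
            have : x ≤ σ := le_csSup hcomp.bddAbove ⟨hxj, hsub hx⟩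
            exact absurd (ht.1.trans_le hx.1) this.not_gt
          simp only [mem_iUnion]
          exact ⟨j, Finset.mem_erase.2 ⟨hji, hj⟩, hxj⟩
        · intro j hj x hx y hy
          exact hL j (Finset.mem_of_mem_erase hj) x ⟨hx.1, hsub hx.2⟩ y ⟨hy.1, hsub hy.2⟩
        · rw [Finset.card_erase_of_mem hi, h]; rfl
      have hlim : Tendsto f (𝓝[Ioo σ b] σ) (𝓝 (f σ)) :=
        (hf σ hσ.2).mono (Ioo_subset_Icc_self.trans (Icc_subset_Icc_left hσ.2.1))
      have hlim2 : Tendsto (fun t : ℝ => t) (𝓝[Ioo σ b] σ) (𝓝 σ) :=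
        tendsto_id.mono_left nhdsWithin_le_nhds
      have : (𝓝[Ioo σ b] σ).NeBot := left_nhdsWithin_Ioo_neBot hlt
      exact le_of_tendsto_of_tendsto (tendsto_const_nhds.sub hlim).abs
        (tendsto_const_nhds.mul (tendsto_const_nhds.sub hlim2))
        (eventually_mem_nhdsWithin.mono key)
    calc |f b - f a| ≤ |f b - f σ| + |f σ - f a| := abs_sub_le _ _ _
      _ ≤ L * (b - a) := by linarith

/-- `f` is Lipschitz along the segments contained in `s`. -/
def LipschitzOnSegments {E : Type*} [NormedAddCommGroup E] [NormedSpace ℝ E] (L : ℝ≥0) (f : E → ℝ)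
    (s : Set E) : Prop :=
  ∀ x y, segment ℝ x y ⊆ s → |f x - f y| ≤ L * ‖x - y‖

/-- Restricting to a segment makes the question one-dimensional: the parametrisation by `[0, 1]` has
speed `‖x - y‖` and pulls the cover back to closed sets. Nothing is claimed for pairs whose segment
leaves the union, which need not be convex. -/
lemma LipschitzOnSegments.of_finite_closed_cover {E : Type*} [NormedAddCommGroup E]
    [NormedSpace ℝ E] {ι : Type*} [Finite ι] {K : ι → Set E} (hK : ∀ i, IsClosed (K i))
    {f : E → ℝ} (hf : ContinuousOn f (⋃ i, K i)) {L : ℝ≥0} (hL : ∀ i, LipschitzOnWith L f (K i)) :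
    LipschitzOnSegments L f (⋃ i, K i) := by
  intro x y hxy
  cases nonempty_fintype ι
  have hc : Continuous (AffineMap.lineMap (k := ℝ) y x) := AffineMap.lineMap_continuous
  have hmem : ∀ t ∈ Icc (0 : ℝ) 1, AffineMap.lineMap y x t ∈ ⋃ i, K i := fun t ht =>
    hxy (by rw [segment_symm, segment_eq_image_lineMap]; exact mem_image_of_mem _ ht)
  have := abs_sub_le_of_finite_closed_cover (A := fun i => AffineMap.lineMap (k := ℝ) y x ⁻¹' K i)
    (fun i => (hK i).preimage hc) (f := f ∘ AffineMap.lineMap (k := ℝ) y x) (a := 0) (b := 1)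
    (L := L * ‖x - y‖) Finset.univ zero_le_one (hf.comp hc.continuousOn hmem)
    (fun t ht => by simpa using hmem t ht) (by
      intro i _ t ht u hu
      have h := (hL i).dist_le_mul _ ht.1 _ hu.1
      rw [dist_lineMap_lineMap, Real.dist_eq, Real.dist_eq, dist_comm, dist_eq_norm] at h
      simp only [Function.comp_apply]
      linarith)
  simpa using this

lemma LipschitzOnSegments.mono {E : Type*} [NormedAddCommGroup E] [NormedSpace ℝ E] {L : ℝ≥0}
    {f : E → ℝ} {s t : Set E} (hf : LipschitzOnSegments L f t) (hst : s ⊆ t) :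
    LipschitzOnSegments L f s :=
  fun x y h => hf x y (h.trans hst)

lemma LipschitzOnSegments.lipschitzOnWith {E : Type*} [NormedAddCommGroup E] [NormedSpace ℝ E]
    {L : ℝ≥0} {f : E → ℝ} {s t : Set E} (hf : LipschitzOnSegments L f s) (ht : Convex ℝ t)
    (hts : t ⊆ s) : LipschitzOnWith L f t :=
  LipschitzOnWith.of_dist_le_mul fun x hx y hy => by
    rw [Real.dist_eq, dist_eq_norm]
    exact hf x y ((ht.segment_subset hx hy).trans hts)

lemma LipschitzOnSegments.norm_fderiv_le {E : Type*} [NormedAddCommGroup E] [NormedSpace ℝ E]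
    {L : ℝ≥0} {f : E → ℝ} {U : Set E} (hf : LipschitzOnSegments L f U) (hU : IsOpen U) {x : E}
    (hx : x ∈ U) : ‖fderiv ℝ f x‖ ≤ L := by
  obtain ⟨r, hr, hrU⟩ := Metric.isOpen_iff.1 hU x hx
  exact norm_fderiv_le_of_lipschitzOn ℝ (Metric.ball_mem_nhds x hr)
    (hf.lipschitzOnWith (convex_ball x r) hrU)

/-- Rademacher's theorem applies on each ball inside `U`, and a locally null set is null. -/
lemma LipschitzOnSegments.ae_differentiableAt {E : Type*} [NormedAddCommGroup E] [NormedSpace ℝ E]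
    [FiniteDimensional ℝ E] [MeasurableSpace E] [BorelSpace E] (μ : Measure E)
    [μ.IsAddHaarMeasure] {L : ℝ≥0} {f : E → ℝ} {U : Set E} (hf : LipschitzOnSegments L f U)
    (hU : IsOpen U) : ∀ᵐ x ∂(μ.restrict U), DifferentiableAt ℝ f x := by
  rw [ae_restrict_iff' hU.measurableSet, ae_iff]
  refine measure_null_of_locally_null _ fun x hx => ?_
  simp only [Classical.not_imp, mem_ofPred_eq] at hx
  obtain ⟨r, hr, hrU⟩ := Metric.isOpen_iff.1 hU x hx.1
  have h := (hf.lipschitzOnWith (convex_ball x r) hrU).ae_differentiableWithinAt_of_mem (μ := μ)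
  refine ⟨_, inter_mem_nhdsWithin _ (Metric.ball_mem_nhds x hr), ?_⟩
  refine measure_mono_null ?_ (ae_iff.1 h)
  rintro y ⟨hy, hyb⟩
  simp only [Classical.not_imp, mem_ofPred_eq] at hy ⊢
  exact ⟨hyb, fun h' => hy.2 (h'.differentiableAt (Metric.isOpen_ball.mem_nhds hyb))⟩

/-- A bounded function that is Lipschitz along the segments of an open set coincides near any
compact subset with a globally Lipschitz function. -/
lemma LipschitzOnSegments.exists_lipschitzWith_eqOn {E : Type*} [NormedAddCommGroup E]
    [NormedSpace ℝ E] {L : ℝ≥0} {f : E → ℝ} {U : Set E} (hf : LipschitzOnSegments L f U)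
    (hU : IsOpen U) {B : ℝ} (hB : ∀ x ∈ U, |f x| ≤ B) {K : Set E} (hK : IsCompact K)
    (hKU : K ⊆ U) :
    ∃ (C : ℝ≥0) (g : E → ℝ) (V : Set E), LipschitzWith C g ∧ IsOpen V ∧ K ⊆ V ∧ V ⊆ U ∧
      EqOn f g V := by
  obtain ⟨δ, hδ, hδU⟩ := hK.exists_thickening_subset_open hU hKU
  have hVU : Metric.thickening (δ / 2) K ⊆ U :=
    (Metric.thickening_mono (by linarith) K).trans hδU
  -- Points closer than `δ / 2` are joined by a segment inside the larger thickening, whence the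
  -- constant `L`. For points further apart the oscillation is at most `2 * B`, whence `2 * B / (δ /
  -- 2)`.
  have hlip : LipschitzOnWith (max L (Real.toNNReal (2 * B / (δ / 2)))) f
      (Metric.thickening (δ / 2) K) := by
    refine LipschitzOnWith.of_dist_le_mul fun x hx y hy => ?_
    rw [Real.dist_eq]
    rcases lt_or_ge (dist x y) (δ / 2) with h | h
    · refine (hf x y ?_).trans ?_
      · refine Subset.trans ?_ hδU
        obtain ⟨z, hz, hxz⟩ := Metric.mem_thickening_iff.1 hx
        have hball : segment ℝ x y ⊆ Metric.ball z δ := by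
          refine (convex_ball z δ).segment_subset ?_ ?_
          · exact hxz.trans (by linarith)
          · have := dist_triangle y x z
            rw [dist_comm y x] at this
            exact Metric.mem_ball.2 (by linarith)
        exact hball.trans (Metric.ball_subset_thickening hz δ)
      · rw [dist_eq_norm, NNReal.coe_max]
        gcongr
        exact le_max_left _ _
    · have h1 : |f x - f y| ≤ 2 * B := by
        have := abs_sub (f x) (f y)
        linarith [hB x (hVU hx), hB y (hVU hy)]
      calc |f x - f y| ≤ 2 * B := h1
        _ = 2 * B / (δ / 2) * (δ / 2) := by field_simp
        _ ≤ max (L : ℝ) (Real.toNNReal (2 * B / (δ / 2))) * dist x y := by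
          refine mul_le_mul ((Real.le_coe_toNNReal _).trans (le_max_right _ _)) h (by positivity)
            (by positivity)
        _ = _ := by rw [NNReal.coe_max]
  obtain ⟨g, hg, hfg⟩ := hlip.extend_real
  exact ⟨_, g, _, hg, Metric.isOpen_thickening, Metric.self_subset_thickening (by linarith) K,
    hVU, hfg⟩

/-- Integration by parts against a test function, for a function that is Lipschitz along the
segments of an open set. -/
lemma LipschitzOnSegments.isWeakGradient {L : ℝ≥0} {f : E3 → ℝ} {U : Set E3}
    (hf : LipschitzOnSegments L f U) (hU : IsOpen U) {B : ℝ} (hB : ∀ x ∈ U, |f x| ≤ B) :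
    IsWeakGradient U f (gradient f) := by
  intro φ hφ hc hs i
  set e : E3 := EuclideanSpace.single i 1
  obtain ⟨C, g, V, hg, hV, hKV, hVU, hfg⟩ := hf.exists_lipschitzWith_eqOn hU hB hc hs
  obtain ⟨D, hD⟩ := ContDiff.lipschitzWith_of_hasCompactSupport hc hφ (by simp)
  -- Integration by parts on the whole space for the global extension `g`. The derivative of `φ` is
  -- taken in direction `-e`, which is the source of the minus sign.
  have key := LipschitzWith.integral_lineDeriv_mul_eq (μ := volume) hg hD hc e
  have hφz : ∀ x ∉ tsupport φ, φ x = 0 := fun x hx => image_eq_zero_of_notMem_tsupport hx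
  have hφz' : ∀ x ∉ tsupport φ, fderiv ℝ φ x = 0 := fun x hx =>
    image_eq_zero_of_notMem_tsupport fun h => hx (tsupport_fderiv_subset ℝ h)
  have h1 : ∫ x in U, f x * fderiv ℝ φ x e = ∫ x, g x * fderiv ℝ φ x e := by
    rw [setIntegral_eq_integral_of_forall_compl_eq_zero]
    · congr with x
      by_cases hx : x ∈ tsupport φ
      · rw [hfg (hKV hx)]
      · simp [hφz' x hx]
    · intro x hx
      simp [hφz' x fun h => hx (hs h)]
  have hcoord : ∀ x, gradient f x i = fderiv ℝ f x e := by
    intro x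
    rw [← inner_gradient_left, EuclideanSpace.inner_single_right]
    simp
  have h2 : ∫ x in U, gradient f x i * φ x = ∫ x, lineDeriv ℝ g x e * φ x := by
    rw [setIntegral_eq_integral_of_forall_compl_eq_zero]
    · refine integral_congr_ae ?_
      -- Agreement of `f` and `g` on the open set `V`, not just on the support of `φ`, is what makes
      -- their derivatives coincide there.
      filter_upwards [hg.ae_differentiableAt (μ := volume)] with x hx
      by_cases hxt : x ∈ tsupport φ
      · have : f =ᶠ[𝓝 x] g := hfg.eventuallyEq_of_mem (hV.mem_nhds (hKV hxt))
        rw [hcoord, this.fderiv_eq, hx.lineDeriv_eq_fderiv]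
      · simp [hφz x hxt]
    · intro x hx
      simp [hφz x fun h => hx (hs h)]
  rw [h1, h2, key, ← integral_neg]
  congr with x
  rw [(hφ.differentiable (by simp)).differentiableAt.lineDeriv_eq_fderiv, map_neg]
  ring

/-! ### Inverse estimates and density of the interior for `C¹` maps -/

lemma HasStrictFDerivAt.exists_nhds_norm_sub_le {E G : Type*} [NormedAddCommGroup E]
    [NormedSpace ℝ E] [NormedAddCommGroup G] [NormedSpace ℝ G] {F : E → G} {F' : E ≃L[ℝ] G} {a : E}
    (hF : HasStrictFDerivAt F (F' : E →L[ℝ] G) a) :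
    ∃ (C : ℝ≥0), ∃ s ∈ 𝓝 a, ∀ x ∈ s, ∀ y ∈ s, ‖x - y‖ ≤ C * ‖F x - F y‖ := by
  obtain ⟨s, has, hs, h⟩ := hF.approximates_deriv_on_open_nhds
  -- On `s`, the error `F - F'` has Lipschitz constant half of `‖F'⁻¹‖⁻¹`, too small to destroy the
  -- lower bound for `F'`; the trivial space is the degenerate alternative.
  obtain ⟨C, h1⟩ : ∃ C, AntilipschitzWith C (s.domRestrict F) := ⟨_, h.antilipschitz
    (F'.subsingleton_or_nnnorm_symm_pos.imp_right fun hp => NNReal.half_lt_self (inv_pos.2 hp).ne')⟩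
  refine ⟨C, s, hs.mem_nhds has, fun x hx y hy => ?_⟩
  have := h1.le_mul_dist ⟨x, hx⟩ ⟨y, hy⟩
  rw [Subtype.dist_eq, dist_eq_norm, dist_eq_norm] at this
  exact this

/-- An injective `C¹` map with invertible derivatives has a Lipschitz inverse on the image of a
compact set, so that the increments of a `C¹` function are controlled by those of the map. -/
lemma exists_abs_sub_le_mul_norm_sub {E G : Type*} [NormedAddCommGroup E] [NormedSpace ℝ E]
    [CompleteSpace E] [NormedAddCommGroup G] [NormedSpace ℝ G] {F : E → G} (hF : ContDiff ℝ 1 F)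
    {p : E → ℝ} (hp : ContDiff ℝ 1 p) {K : Set E} (hK : IsCompact K) (hinj : InjOn F K)
    (hinv : ∀ x ∈ K, (fderiv ℝ F x).IsInvertible) :
    ∃ C : ℝ≥0, ∀ x ∈ K, ∀ y ∈ K, |p x - p y| ≤ C * ‖F x - F y‖ := by
  suffices h : ∃ C : ℝ≥0, ∀ z ∈ K ×ˢ K, |p z.1 - p z.2| ≤ C * ‖F z.1 - F z.2‖ by
    obtain ⟨C, hC⟩ := h
    exact ⟨C, fun x hx y hy => hC (x, y) ⟨hx, hy⟩⟩
  -- By compactness of `K ×ˢ K` it suffices to find a constant near each pair. At a diagonal pair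
  -- the invertible derivative gives it; off the diagonal, injectivity keeps `‖F x - F y‖` away from
  -- zero.
  refine (hK.prod hK).induction_on
    (p := fun S => ∃ C : ℝ≥0, ∀ z ∈ S, |p z.1 - p z.2| ≤ C * ‖F z.1 - F z.2‖) ⟨0, by simp⟩
    (fun s t hst ⟨C, hC⟩ => ⟨C, fun z hz => hC z (hst hz)⟩) ?_ ?_
  · rintro s t ⟨C, hC⟩ ⟨D, hD⟩
    refine ⟨max C D, ?_⟩
    rw [NNReal.coe_max]
    rintro z (hz | hz)
    · exact (hC z hz).trans (by gcongr; exact le_max_left _ _)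
    · exact (hD z hz).trans (by gcongr; exact le_max_right _ _)
  · rintro ⟨a, b⟩ ⟨ha, hb⟩
    by_cases hab : a = b
    · subst hab
      obtain ⟨F', hF'⟩ := hinv a ha
      have hst : HasStrictFDerivAt F (F' : E →L[ℝ] G) a :=
        hF' ▸ hF.contDiffAt.hasStrictFDerivAt one_ne_zero
      obtain ⟨C, s, hs, h1⟩ := hst.exists_nhds_norm_sub_le
      obtain ⟨D, t, ht, h2⟩ := (hp.contDiffAt (x := a)).exists_lipschitzOnWith
      refine ⟨(s ∩ t) ×ˢ (s ∩ t), mem_nhdsWithin_of_mem_nhds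
        (prod_mem_nhds (inter_mem hs ht) (inter_mem hs ht)), D * C, ?_⟩
      rintro ⟨x, y⟩ ⟨hx, hy⟩
      have h3 := h2.dist_le_mul x hx.2 y hy.2
      rw [Real.dist_eq, dist_eq_norm] at h3
      calc |p x - p y| ≤ D * ‖x - y‖ := h3
        _ ≤ D * (C * ‖F x - F y‖) := by gcongr; exact h1 x hx.1 y hy.1
        _ = _ := by push_cast; ring
    · have hne : F a - F b ≠ 0 := sub_ne_zero.2 fun h => hab (hinj ha hb h)
      have hq : ContinuousAt (fun z : E × E => |p z.1 - p z.2| / ‖F z.1 - F z.2‖) (a, b) := by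
        have := hp.continuous
        have := hF.continuous
        refine ContinuousAt.div ?_ ?_ (norm_ne_zero_iff.2 hne)
        · exact Continuous.continuousAt (by fun_prop)
        · exact Continuous.continuousAt (by fun_prop)
      have hn : ∀ᶠ z : E × E in 𝓝 (a, b), F z.1 - F z.2 ≠ 0 := by
        have := hF.continuous
        exact (Continuous.continuousAt (by fun_prop)).eventually_ne hne
      -- The quotient is continuous at `(a, b)`, so it stays below its value there plus one on a
      -- neighbourhood.
      set C : ℝ := |p a - p b| / ‖F a - F b‖ + 1
      have hC : 0 ≤ C := by positivity
      refine ⟨_, mem_nhdsWithin_of_mem_nhds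
        ((hq.eventually (gt_mem_nhds (lt_add_one _))).and hn), C.toNNReal, ?_⟩
      rintro z ⟨h1, h2⟩
      rw [Real.coe_toNNReal _ hC]
      exact ((div_lt_iff₀ (norm_pos_iff.2 h2)).1 h1).le

/-- A set which is the closure of its interior is mapped into the closure of the interior of its
image by a `C¹` map with invertible derivatives. -/
lemma image_subset_closure_interior {E G : Type*} [NormedAddCommGroup E] [NormedSpace ℝ E]
    [CompleteSpace E] [NormedAddCommGroup G] [NormedSpace ℝ G] {F : E → G} (hF : ContDiff ℝ 1 F)
    {K : Set E} (hK : K ⊆ closure (interior K)) (hinv : ∀ x ∈ K, (fderiv ℝ F x).IsInvertible) :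
    F '' K ⊆ closure (interior (F '' K)) := by
  refine (image_mono hK).trans ((image_closure_subset_closure_image hF.continuous).trans
    (closure_mono ?_))
  rintro _ ⟨x, hx, rfl⟩
  obtain ⟨F', hF'⟩ := hinv x (interior_subset hx)
  have hst : HasStrictFDerivAt F (F' : E →L[ℝ] G) x :=
    hF' ▸ hF.contDiffAt.hasStrictFDerivAt one_ne_zero
  -- The inverse function theorem: `F` is open at `x`, so it sends interior points of `K` to
  -- interior points of the image.
  rw [mem_interior_iff_mem_nhds, ← hst.map_nhds_eq_of_equiv]
  exact image_mem_map (mem_interior_iff_mem_nhds.1 hx)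

/-! ### Membership in `H¹` -/

lemma IsWeakGradient.congr_ae {U : Set E3} {u u' : E3 → ℝ} {g g' : E3 → E3}
    (h : IsWeakGradient U u g) (hu : u =ᵐ[volume.restrict U] u')
    (hg : g =ᵐ[volume.restrict U] g') : IsWeakGradient U u' g' := by
  intro φ hφ hc hs i
  have h1 : ∫ x in U, u' x * fderiv ℝ φ x (EuclideanSpace.single i 1)
      = ∫ x in U, u x * fderiv ℝ φ x (EuclideanSpace.single i 1) :=
    integral_congr_ae (by filter_upwards [hu] with x hx; rw [hx])
  have h2 : ∫ x in U, g' x i * φ x = ∫ x in U, g x i * φ x :=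
    integral_congr_ae (by filter_upwards [hg] with x hx; rw [hx])
  rw [h1, h2, h φ hφ hc hs i]

lemma LipschitzOnSegments.continuousOn {E : Type*} [NormedAddCommGroup E] [NormedSpace ℝ E]
    {L : ℝ≥0} {f : E → ℝ} {U : Set E} (hf : LipschitzOnSegments L f U) (hU : IsOpen U) :
    ContinuousOn f U := by
  intro x hx
  obtain ⟨r, hr, hrU⟩ := Metric.isOpen_iff.1 hU x hx
  exact ((hf.lipschitzOnWith (convex_ball x r) hrU).continuousOn.continuousAt
    (Metric.ball_mem_nhds x hr)).continuousWithinAt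

/-- Bounded functions that are Lipschitz along the segments of `U`. -/
def boundedLipschitzOnSegments (U : Set E3) : Submodule ℝ (E3 → ℝ) where
  carrier := {f | (∃ L, LipschitzOnSegments L f U) ∧ ∃ B, ∀ x ∈ U, |f x| ≤ B}
  zero_mem' := ⟨⟨0, fun x y _ => by simp⟩, 0, by simp⟩
  add_mem' := by
    rintro f g ⟨⟨L, hL⟩, B, hB⟩ ⟨⟨L', hL'⟩, B', hB'⟩
    refine ⟨⟨L + L', fun x y h => ?_⟩, B + B', fun x hx => ?_⟩
    · have h1 := hL x y h
      have h2 := hL' x y h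
      calc |(f + g) x - (f + g) y| = |(f x - f y) + (g x - g y)| := by
            simp only [Pi.add_apply]; congr 1; ring
        _ ≤ |f x - f y| + |g x - g y| := abs_add_le _ _
        _ ≤ _ := by push_cast; linarith
    · exact (abs_add_le _ _).trans (add_le_add (hB x hx) (hB' x hx))
  smul_mem' := by
    rintro r f ⟨⟨L, hL⟩, B, hB⟩
    refine ⟨⟨‖r‖₊ * L, fun x y h => ?_⟩, |r| * B, fun x hx => ?_⟩
    · rw [Pi.smul_apply, Pi.smul_apply, ← smul_sub, smul_eq_mul, abs_mul, NNReal.coe_mul,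
        coe_nnnorm, Real.norm_eq_abs, mul_assoc]
      exact mul_le_mul_of_nonneg_left (hL x y h) (abs_nonneg r)
    · rw [Pi.smul_apply, smul_eq_mul, abs_mul]
      exact mul_le_mul_of_nonneg_left (hB x hx) (abs_nonneg r)

section

variable {U : Set E3}

lemma boundedLipschitzOnSegments.memLp (hU : IsOpen U) (hv : volume U ≠ ⊤)
    (f : boundedLipschitzOnSegments U) : MemLp f.1 2 (volume.restrict U) := by
  obtain ⟨f, ⟨L, hL⟩, B, hB⟩ := f
  have : IsFiniteMeasure (volume.restrict U) := ⟨by simpa using hv.lt_top⟩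
  exact MemLp.of_bound ((hL.continuousOn hU).aestronglyMeasurable hU.measurableSet) B
    ((ae_restrict_iff' hU.measurableSet).2 (ae_of_all _ hB))

lemma boundedLipschitzOnSegments.memLp_gradient (hU : IsOpen U) (hv : volume U ≠ ⊤)
    (f : boundedLipschitzOnSegments U) : MemLp (gradient f.1) 2 (volume.restrict U) := by
  obtain ⟨f, ⟨L, hL⟩, -⟩ := f
  have : IsFiniteMeasure (volume.restrict U) := ⟨by simpa using hv.lt_top⟩
  -- The total function `fderiv` is measurable for arbitrary `f`, so the points of
  -- non-differentiability need no separate treatment.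
  have hm : Measurable (gradient f) :=
    (InnerProductSpace.toDual ℝ E3).symm.continuous.measurable.comp (measurable_fderiv ℝ f)
  refine MemLp.of_bound hm.aestronglyMeasurable L
    ((ae_restrict_iff' hU.measurableSet).2 (ae_of_all _ fun x hx => ?_))
  rw [gradient, LinearIsometryEquiv.norm_map]
  exact hL.norm_fderiv_le hU hx

lemma boundedLipschitzOnSegments.ae_differentiableAt (hU : IsOpen U)
    (f : boundedLipschitzOnSegments U) : ∀ᵐ x ∂(volume.restrict U), DifferentiableAt ℝ f.1 x :=
  f.2.1.choose_spec.ae_differentiableAt volume hU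

/-- The embedding `f ↦ (f, ∇f)` into `H¹(U)`. -/
def boundedLipschitzOnSegments.toH1 (hU : IsOpen U) (hv : volume U ≠ ⊤) :
    boundedLipschitzOnSegments U →ₗ[ℝ] H1 U where
  toFun f := ⟨WithLp.toLp 2 ((memLp hU hv f).toLp f.1,
    (memLp_gradient hU hv f).toLp (gradient f.1)), by
      exact (f.2.1.choose_spec.isWeakGradient hU f.2.2.choose_spec).congr_ae
        (memLp hU hv f).coeFn_toLp.symm (memLp_gradient hU hv f).coeFn_toLp.symm⟩
  map_add' f g := by
    refine Subtype.ext (congrArg (WithLp.toLp 2) (Prod.ext ?_ ?_))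
    · exact MemLp.toLp_add (memLp hU hv f) (memLp hU hv g)
    · refine Eq.trans (MemLp.toLp_congr (memLp_gradient hU hv (f + g))
        ((memLp_gradient hU hv f).add (memLp_gradient hU hv g)) ?_)
        (MemLp.toLp_add (memLp_gradient hU hv f) (memLp_gradient hU hv g))
      -- The gradient is additive only where both functions are differentiable, which is enough for
      -- classes in `L²`.
      filter_upwards [ae_differentiableAt hU f, ae_differentiableAt hU g] with x hf hg
      simp only [gradient, Pi.add_apply, Submodule.coe_add]
      rw [fderiv_add hf hg, map_add]
  map_smul' r f := by
    refine Subtype.ext (congrArg (WithLp.toLp 2) (Prod.ext ?_ ?_))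
    · exact MemLp.toLp_const_smul r (memLp hU hv f)
    · refine Eq.trans (MemLp.toLp_congr (memLp_gradient hU hv (r • f))
        ((memLp_gradient hU hv f).const_smul r) ?_)
        (MemLp.toLp_const_smul r (memLp_gradient hU hv f))
      filter_upwards [ae_differentiableAt hU f] with x hf
      simp only [gradient, Pi.smul_apply, Submodule.coe_smul]
      rw [fderiv_const_smul hf]
      simp

lemma boundedLipschitzOnSegments.coeFn_toH1_fst (hU : IsOpen U) (hv : volume U ≠ ⊤)
    (f : boundedLipschitzOnSegments U) :
    ((toH1 hU hv f : L2Pair U).fst : E3 → ℝ) =ᵐ[volume.restrict U] f.1 :=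
  (memLp hU hv f).coeFn_toLp

end

/-! ### Reference elements and element mappings -/

lemma contDiff_bary (i : Fin 4) : ContDiff ℝ 1 (bary i) := by
  unfold bary
  fin_cases i <;> simp <;> fun_prop

lemma continuous_bary (i : Fin 4) : Continuous (bary i) :=
  (contDiff_bary i).continuous

lemma contDiff_triAffine (c : Corner) : ContDiff ℝ 1 (triAffine c) := by
  unfold triAffine
  refine contDiff_prod fun i _ => ?_
  split_ifs <;> fun_prop

lemma contDiff_eval (p : MvPolynomial (Fin 3) ℝ) :
    ContDiff ℝ 1 fun x : E3 => MvPolynomial.eval (fun i => x i) p := by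
  induction p using MvPolynomial.induction_on with
  | C a => simpa using contDiff_const
  | add p q hp hq => simpa using hp.add hq
  | mul_X p i hp => simpa using hp.mul (by fun_prop)

lemma isBounded_of_coord_mem_Icc {s : Set E3} (h : ∀ x ∈ s, ∀ i, x i ∈ Icc (0 : ℝ) 1) :
    Bornology.IsBounded s := by
  refine isBounded_iff_forall_norm_le.2 ⟨√3, fun x hx => ?_⟩
  rw [EuclideanSpace.norm_eq]
  refine Real.sqrt_le_sqrt ?_
  have : ∀ i, ‖x i‖ ^ 2 ≤ 1 := fun i => by
    rw [Real.norm_eq_abs, sq_abs]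
    nlinarith [(h x hx i).1, (h x hx i).2]
  calc ∑ i, ‖x i‖ ^ 2 ≤ ∑ _i : Fin 3, (1 : ℝ) := Finset.sum_le_sum fun i _ => this i
    _ = 3 := by simp

lemma isCompact_refTet : IsCompact refTet := by
  refine Metric.isCompact_of_isClosed_isBounded ?_ (isBounded_of_coord_mem_Icc fun x hx i => ?_)
  · simp only [refTet, ofPred_forall]
    exact isClosed_iInter fun i => isClosed_le continuous_const (continuous_bary i)
  · have h0 := hx 0
    have h1 := hx 1
    have h2 := hx 2
    have h3 := hx 3
    simp [bary] at h0 h1 h2 h3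
    constructor <;> fin_cases i <;> simp <;> linarith

lemma isCompact_refHex : IsCompact refHex := by
  refine Metric.isCompact_of_isClosed_isBounded ?_ (isBounded_of_coord_mem_Icc fun x hx => hx)
  simp only [refHex, ofPred_forall]
  exact isClosed_iInter fun i => isClosed_Icc.preimage (by fun_prop)

lemma convex_refTet : Convex ℝ refTet := by
  intro x hx y hy a b ha hb hab k
  have : bary k (a • x + b • y) = a * bary k x + b * bary k y := by
    obtain rfl : b = 1 - a := by linarith
    fin_cases k <;> simp [bary] <;> ring
  rw [this]
  exact add_nonneg (mul_nonneg ha (hx k)) (mul_nonneg hb (hy k))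

lemma convex_refHex : Convex ℝ refHex := by
  intro x hx y hy a b ha hb hab i
  exact (convex_Icc (0 : ℝ) 1) (hx i) (hy i) ha hb hab

/-- A convex set with an interior point lies in the closure of its interior; here that point is the
barycentre, all of whose barycentric coordinates are `1 / 4`. -/
lemma refTet_subset_closure_interior : refTet ⊆ closure (interior refTet) := by
  rw [convex_refTet.closure_interior_eq_closure_of_nonempty_interior]
  · exact subset_closure
  refine ⟨WithLp.toLp 2 fun _ => 1 / 4, mem_interior.2 ⟨{x | ∀ i, 0 < bary i x},
    fun x hx i => (hx i).le, ?_, fun i => ?_⟩⟩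
  · simp only [ofPred_forall]
    exact isOpen_iInter_of_finite fun i => isOpen_lt continuous_const (continuous_bary i)
  · fin_cases i <;> simp [bary] <;> norm_num

lemma refHex_subset_closure_interior : refHex ⊆ closure (interior refHex) := by
  rw [convex_refHex.closure_interior_eq_closure_of_nonempty_interior]
  · exact subset_closure
  refine ⟨WithLp.toLp 2 fun _ => 1 / 2, mem_interior.2 ⟨{x | ∀ i, x i ∈ Ioo (0 : ℝ) 1},
    fun x hx i => Ioo_subset_Icc_self (hx i), ?_, fun i => ?_⟩⟩
  · simp only [ofPred_forall]
    exact isOpen_iInter_of_finite fun i => isOpen_Ioo.preimage (by fun_prop)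
  · constructor <;> norm_num

namespace HybridMesh

variable {V T H : Type*} (M : HybridMesh V T H)

lemma contDiff_hexMap (q : H) : ContDiff ℝ 1 (M.hexMap q) := by
  unfold hexMap
  exact ContDiff.sum fun c _ => (contDiff_triAffine c).smul contDiff_const

lemma contDiff_tetMap (t : T) : ContDiff ℝ 1 (M.tetMap t) := by
  unfold tetMap
  refine ContDiff.add (ContDiff.sum fun i _ => ?_)
    (ContDiff.sum fun i _ => ContDiff.sum fun j _ => ?_)
  · have := contDiff_bary i
    fun_prop
  · have := contDiff_bary i
    have := contDiff_bary j
    fun_prop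

/-- The reference element of a cell. -/
def refCell : T ⊕ H → Set E3 := Sum.elim (fun _ => refTet) (fun _ => refHex)

/-- The element mapping of a cell. -/
def cellMap : T ⊕ H → E3 → E3 := Sum.elim M.tetMap M.hexMap

lemma region_eq_iUnion : M.region = ⋃ c, M.cellMap c '' refCell c := by
  rw [iUnion_sum]; rfl

lemma contDiff_cellMap (c : T ⊕ H) : ContDiff ℝ 1 (M.cellMap c) := by
  rcases c with t | q
  exacts [M.contDiff_tetMap t, M.contDiff_hexMap q]

lemma isCompact_refCell (c : T ⊕ H) : IsCompact (refCell c) := by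
  rcases c with t | q
  exacts [isCompact_refTet, isCompact_refHex]

lemma refCell_subset_closure_interior (c : T ⊕ H) : refCell c ⊆ closure (interior (refCell c)) := by
  rcases c with t | q
  exacts [refTet_subset_closure_interior, refHex_subset_closure_interior]

lemma isCompact_cell (c : T ⊕ H) : IsCompact (M.cellMap c '' refCell c) :=
  (isCompact_refCell c).image (M.contDiff_cellMap c).continuous

lemma isCompact_region [Finite T] [Finite H] : IsCompact M.region := by
  rw [region_eq_iUnion]
  exact isCompact_iUnion M.isCompact_cell

variable {M}

lemma IsNondegenerate.injOn (hM : M.IsNondegenerate) (c : T ⊕ H) :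
    InjOn (M.cellMap c) (refCell c) := by
  rcases c with t | q
  exacts [(hM.1 t).1, (hM.2 q).1]

lemma IsNondegenerate.isInvertible_fderiv (hM : M.IsNondegenerate) (c : T ⊕ H) :
    ∀ x ∈ refCell c, (fderiv ℝ (M.cellMap c) x).IsInvertible := by
  have h : ∀ x ∈ refCell c, (fderiv ℝ (M.cellMap c) x).det ≠ 0 := by
    rcases c with t | q
    exacts [(hM.1 t).2, (hM.2 q).2]
  exact fun x hx => ⟨_, ContinuousLinearMap.coe_toContinuousLinearEquivOfDetNeZero _ (h x hx)⟩

/-- Each reference element has dense interior, and its mapping carries this over to the cell. It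
lets information on the open set `interior M.region` reach the boundary of the region. -/
lemma IsNondegenerate.region_subset_closure_interior (hM : M.IsNondegenerate) :
    M.region ⊆ closure (interior M.region) := by
  have h : M.region = ⋃ c, M.cellMap c '' refCell c := M.region_eq_iUnion
  nth_rw 1 [h]
  refine iUnion_subset fun c => (image_subset_closure_interior (M.contDiff_cellMap c)
    (refCell_subset_closure_interior c) (hM.isInvertible_fderiv c)).trans ?_
  rw [h]
  exact closure_mono (interior_mono (subset_iUnion_of_subset c Subset.rfl))

variable (M)

/-! ### Functions on the meshed region -/

/-- Extension by zero of a function on the meshed region. -/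
def extendZero : C(M.region, ℝ) →ₗ[ℝ] E3 → ℝ where
  toFun v := Function.extend Subtype.val v 0
  map_add' v w := by
    ext x
    by_cases hx : ∃ y : M.region, y.1 = x
    · obtain ⟨y, rfl⟩ := hx
      simp
    · simp [Function.extend_apply' _ _ _ hx]
  map_smul' r v := by
    ext x
    by_cases hx : ∃ y : M.region, y.1 = x
    · obtain ⟨y, rfl⟩ := hx
      simp
    · simp [Function.extend_apply' _ _ _ hx]

variable {M}

lemma extendZero_coe (v : C(M.region, ℝ)) (x : M.region) : M.extendZero v x = v x :=
  Subtype.val_injective.extend_apply _ _ x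

lemma continuousOn_extendZero (v : C(M.region, ℝ)) : ContinuousOn (M.extendZero v) M.region := by
  rw [continuousOn_iff_continuous_domRestrict]
  exact v.continuous.congr fun x => (extendZero_coe v x).symm

/-- The degree bounds are dropped: regularity only needs the pull-back to be a polynomial, and the
degrees matter again only for the dimension. -/
lemma exists_eval_eq_of_mem_hyb12 {v : C(M.region, ℝ)} (hv : v ∈ M.hyb12) (c : T ⊕ H) :
    ∃ p : MvPolynomial (Fin 3) ℝ, ∀ x ∈ refCell c,
      M.extendZero v (M.cellMap c x) = MvPolynomial.eval (fun i => x i) p := by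
  rcases c with t | q
  · obtain ⟨p, -, hp⟩ := hv.1 t
    exact ⟨p, fun x hx => (extendZero_coe v ⟨_, M.tetMap_mem t hx⟩).trans (hp ⟨x, hx⟩)⟩
  · obtain ⟨p, -, hp⟩ := hv.2 q
    exact ⟨p, fun x hx => (extendZero_coe v ⟨_, M.hexMap_mem q hx⟩).trans (hp ⟨x, hx⟩)⟩

lemma IsNondegenerate.exists_lipschitzOnWith_cell (hM : M.IsNondegenerate) {v : C(M.region, ℝ)}
    (hv : v ∈ M.hyb12) (c : T ⊕ H) :
    ∃ L, LipschitzOnWith L (M.extendZero v) (M.cellMap c '' refCell c) := by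
  obtain ⟨p, hp⟩ := exists_eval_eq_of_mem_hyb12 hv c
  obtain ⟨L, hL⟩ := exists_abs_sub_le_mul_norm_sub (M.contDiff_cellMap c) (contDiff_eval p)
    (isCompact_refCell c) (hM.injOn c) (hM.isInvertible_fderiv c)
  refine ⟨L, LipschitzOnWith.of_dist_le_mul ?_⟩
  rintro _ ⟨x, hx, rfl⟩ _ ⟨y, hy, rfl⟩
  rw [hp x hx, hp y hy, Real.dist_eq, dist_eq_norm]
  exact hL x hx y hy

/-- Finitely many cells allow a common Lipschitz constant, and continuity of `v` glues the cellwise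
bounds. -/
lemma IsNondegenerate.exists_lipschitzOnSegments [Finite T] [Finite H] (hM : M.IsNondegenerate)
    {v : C(M.region, ℝ)} (hv : v ∈ M.hyb12) :
    ∃ L, LipschitzOnSegments L (M.extendZero v) M.region := by
  choose L hL using hM.exists_lipschitzOnWith_cell hv
  obtain ⟨C, hC⟩ := (finite_range L).bddAbove
  refine ⟨C, ?_⟩
  have h : M.region ⊆ ⋃ c, M.cellMap c '' refCell c := M.region_eq_iUnion.subset
  exact (LipschitzOnSegments.of_finite_closed_cover (fun c => (M.isCompact_cell c).isClosed)
    ((continuousOn_extendZero v).mono M.region_eq_iUnion.superset)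
    fun c => (hL c).weaken (hC (mem_range_self c))).mono h

lemma exists_abs_extendZero_le [Finite T] [Finite H] (v : C(M.region, ℝ)) :
    ∃ B, ∀ x ∈ M.region, |M.extendZero v x| ≤ B :=
  M.isCompact_region.exists_bound_of_continuousOn (continuousOn_extendZero v)

lemma IsNondegenerate.extendZero_mem [Finite T] [Finite H] (hM : M.IsNondegenerate)
    {v : C(M.region, ℝ)} (hv : v ∈ M.hyb12) :
    M.extendZero v ∈ boundedLipschitzOnSegments (interior M.region) := by
  obtain ⟨L, hL⟩ := hM.exists_lipschitzOnSegments hv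
  obtain ⟨B, hB⟩ := exists_abs_extendZero_le v
  exact ⟨⟨L, hL.mono interior_subset⟩, B, fun x hx => hB x (interior_subset hx)⟩

/-! ### The embedding into `H¹` and its injectivity -/

variable (M) in
lemma volume_interior_region_ne_top [Finite T] [Finite H] : volume (interior M.region) ≠ ⊤ :=
  measure_ne_top_of_subset interior_subset M.isCompact_region.measure_ne_top

/-- The embedding of `ℋyb₁₂` into `H¹`. -/
def hyb12ToH1 [Finite T] [Finite H] (hM : M.IsNondegenerate) :
    M.hyb12 →ₗ[ℝ] H1 (interior M.region) :=
  (boundedLipschitzOnSegments.toH1 isOpen_interior M.volume_interior_region_ne_top).comp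
    ((M.extendZero.comp M.hyb12.subtype).codRestrict _ fun v => hM.extendZero_mem v.2)

lemma coeFn_hyb12ToH1_fst [Finite T] [Finite H] (hM : M.IsNondegenerate) (v : M.hyb12) :
    ((hyb12ToH1 hM v : L2Pair (interior M.region)).fst : E3 → ℝ)
      =ᵐ[volume.restrict (interior M.region)] M.extendZero v.1 :=
  boundedLipschitzOnSegments.coeFn_toH1_fst isOpen_interior M.volume_interior_region_ne_top _

/-- A continuous function that is zero almost everywhere on an open set is zero on it, and then on
every part of its domain of continuity where that open set is dense. -/
lemma hyb12ToH1_injective [Finite T] [Finite H] (hM : M.IsNondegenerate) :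
    Function.Injective (hyb12ToH1 hM) := by
  refine (injective_iff_map_eq_zero _).2 fun v hv => ?_
  have h := coeFn_hyb12ToH1_fst hM v
  rw [hv] at h
  have h0 : M.extendZero v.1 =ᵐ[volume.restrict (interior M.region)] fun _ => (0 : ℝ) :=
    h.symm.trans (Lp.coeFn_zero _ _ _)
  have h1 : EqOn (M.extendZero v.1) (fun _ => 0) (interior M.region) :=
    Measure.eqOn_open_of_ae_eq h0 isOpen_interior
      ((continuousOn_extendZero v.1).mono interior_subset) continuousOn_const
  have h2 : EqOn (M.extendZero v.1) (fun _ => 0) M.region :=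
    h1.of_subset_closure (continuousOn_extendZero v.1) continuousOn_const interior_subset
      hM.region_subset_closure_interior
  ext x
  rw [← extendZero_coe]
  exact h2 x.2

/-! ### Finite dimension -/

variable (M)

/-- Restriction of polynomials to functions on a set. -/
def evalOn (s : Set E3) : MvPolynomial (Fin 3) ℝ →ₗ[ℝ] s → ℝ :=
  LinearMap.pi fun x => (MvPolynomial.aeval fun i => x.1 i).toLinearMap

lemma evalOn_apply (s : Set E3) (p : MvPolynomial (Fin 3) ℝ) (x : s) :
    evalOn s p x = MvPolynomial.eval (fun i => x.1 i) p := by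
  simp [evalOn, MvPolynomial.aeval_eq_eval]

/-- The pull-backs of a function of `ℋyb₁₂` to the reference elements. -/
def hyb12Pull : M.hyb12 →ₗ[ℝ]
    (T → (MvPolynomial.restrictTotalDegree (Fin 3) ℝ 2).map (evalOn refTet)) ×
    (H → (MvPolynomial.restrictDegree (Fin 3) ℝ 1).map (evalOn refHex)) where
  -- The target consists of polynomial functions rather than polynomials, so the map is linear by
  -- definition and no representing polynomial has to be chosen or shown unique.
  toFun v := (fun t => ⟨M.tetPull v.1 t, by
      obtain ⟨p, hp, h⟩ := v.2.1 t
      exact ⟨p, hp, funext fun x => (evalOn_apply _ _ _).trans (h x).symm⟩⟩,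
    fun q => ⟨M.hexPull v.1 q, by
      obtain ⟨p, hp, h⟩ := v.2.2 q
      exact ⟨p, hp, funext fun x => (evalOn_apply _ _ _).trans (h x).symm⟩⟩)
  map_add' _ _ := rfl
  map_smul' _ _ := rfl

/-- The cells cover the region, so every value of a function is a value of one of its pull-backs. -/
lemma hyb12Pull_injective : Function.Injective M.hyb12Pull := by
  intro v w h
  ext ⟨y, hy⟩
  rcases hy with hy | hy
  · obtain ⟨t, x, hx, rfl⟩ := mem_iUnion.1 hy
    exact congrFun (congrArg Subtype.val (congrFun (congrArg Prod.fst h) t)) ⟨x, hx⟩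
  · obtain ⟨q, x, hx, rfl⟩ := mem_iUnion.1 hy
    exact congrFun (congrArg Subtype.val (congrFun (congrArg Prod.snd h) q)) ⟨x, hx⟩

instance finiteDimensional_hyb12 [Finite T] [Finite H] : FiniteDimensional ℝ M.hyb12 :=
  Module.Finite.of_injective M.hyb12Pull M.hyb12Pull_injective

end HybridMesh

end

theorem mainTheorem3 {V T H : Type*} [Finite T] [Finite H] (M : HybridMesh V T H)
    (hM : M.IsNondegenerate) :
    ∃ J : M.hyb12 →ₗ[ℝ] H1 (interior M.region),
      Function.Injective J ∧
      (∀ v : M.hyb12, ∀ᵐ x ∂(volume.restrict (interior M.region)),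
        ∀ hx : x ∈ M.region, (J v : L2Pair (interior M.region)).fst x = v.1 ⟨x, hx⟩) ∧
      CompleteSpace (LinearMap.range J) ∧
      CompleteSpace ((M.hyb1.submoduleOf M.hyb12).map J) ∧
      CompleteSpace ((M.hyb1Full.submoduleOf M.hyb12).map J) := by
  -- All three images are finite-dimensional, being images of subspaces of `M.hyb12`, hence complete
  -- whatever averaging conditions cut them out.
  refine ⟨HybridMesh.hyb12ToH1 hM, HybridMesh.hyb12ToH1_injective hM, fun v => ?_,
    FiniteDimensional.complete ℝ _, FiniteDimensional.complete ℝ _, FiniteDimensional.complete ℝ _⟩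
  filter_upwards [HybridMesh.coeFn_hyb12ToH1_fst hM v] with x h hx
  rw [h]
  exact HybridMesh.extendZero_coe v.1 ⟨x, hx⟩
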